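/- Let $\Omega\subset\mathbb{R}^d$, $d\ge 1$, be a bounded open set (for example a bounded Lipschitz domain with $d\in\{1,2,3\}$). Write $(\cdot,\cdot)$ and $\|\cdot\|$ for the inner products and norms of $L^2(\Omega)$ and $[L^2(\Omega)]^d$, and put $V:=H^1_0(\Omega)$ and $H(\mathrm{div},\Omega):=\{\boldsymbol\tau\in[L^2(\Omega)]^d:\mathrm{div}\,\boldsymbol\tau\in L^2(\Omega)\}$ (weak divergence). Let $y_d,u_d,f\in L^2(\Omega)$ and $\lambda>0$, and let $\nu$ be measurable on $\Omega$ with $0<\underline\nu\le\nu\le\overline\nu$ a.e. in $\Omega$ for constants $\underline\nu,\overline\nu$. For $v\in L^2(\Omega)$ the state $y(v)\in V$ is the weak solution of $-\mathrm{div}(\nu\nabla y)=f+v$, i.e. $$\int_\Omega\nu\nabla y(v)\cdot\nabla w\,dx=\int_\Omega(f+v)\,w\,dx\qquad\forall\,w\in V .$$ Consider the unconstrained problem, $U_{\rm ad}=L^2(\Omega)$, of minimizing over $v\in L^2(\Omega)$ the cost $$\mathcal J(y(v),v)=\tfrac12\|y(v)-y_d\|^2+\tfrac\lambda2\|v-u_d\|^2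 .$$ A Friedrichs constant is a number $C_F>0$ with $\|w\|\le C_F\|\nabla w\|$ for all $w\in V$. For controls $u,v\in L^2(\Omega)$ set $$|||u-v|||^2:=\tfrac12\|y(u)-y(v)\|^2+\tfrac\lambda2\|u-v\|^2,$$ and for $\zeta\in V$ set $v_\zeta:=u_d-\frac1\lambda\zeta$. **Theorem.** There is a Friedrichs constant; every $v\in L^2(\Omega)$ has exactly one state $y(v)$; and there is exactly one optimal control $u\in L^2(\Omega)$. For this $u$, every Friedrichs constant $C_F$, all $\eta,\zeta\in V$, all $\boldsymbol\tau,\boldsymbol\rho\in H(\mathrm{div},\Omega)$ and all $\alpha,\beta>0$, $$|||u-v_\zeta|||^2\le\mathcal M^\oplus(\alpha,\beta;\eta,\zeta,\boldsymbol\tau,\boldsymbol\rho):=\mathcal J^\oplus(\alpha,\beta;\eta,\zeta,\boldsymbol\tau)-\mathcal J^\ominus(\eta,\zeta,\boldsymbol\tau,\boldsymbol\rho),$$ where, with the abbreviations $r:=f+u_d-\frac1\lambda\zeta+\mathrm{div}\,\boldsymbol\tau$, $s:=\boldsymbol\tau-\nu\nabla\eta$, $a:=\|\eta-y_d+\mathrm{div}\,\boldsymbol\rho\|$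 and $b:=\|\boldsymbol\rho-\nu\nabla\zeta\|$, $$\mathcal J^\oplus=\frac{1+\alpha}2\|\eta-y_d\|^2+\frac{(1+\alpha)(1+\beta)C_F^2}{2\alpha\underline\nu^2}\|s\|^2+\frac{(1+\alpha)(1+\beta)C_F^4}{2\alpha\beta\underline\nu^2}\|r\|^2+\frac1{2\lambda}\|\zeta\|^2,$$ $$\mathcal J^\ominus=\frac12\|\eta-y_d\|^2+\frac1{2\lambda}\|\zeta\|^2+(r,\zeta)+(s,\nabla\zeta)-\frac1{\underline\nu}\left(C_Fa+b\right)\left(\frac{C_F^3}{\lambda\underline\nu}a+\frac{C_F^2}{\lambda\underline\nu}b+C_F\|r\|+\|s\|\right).$$ Moreover, $$\mathcal M^\oplus=\frac\alpha2\|\eta-y_d\|^2+\frac{(1+\alpha)(1+\beta)C_F^2}{2\alpha\underline\nu^2}\|s\|^2+\frac{(1+\alpha)(1+\beta)C_F^4}{2\alpha\beta\underline\nu^2}\|r\|^2-(r,\zeta)-(s,\nabla\zeta)+\frac1{\underline\nu}\left(C_Fa+b\right)\left(\frac{C_F^3}{\lambda\underline\nu}a+\frac{C_F^2}{\lambda\underline\nu}b+C_F\|r\|+\|s\|\right).$$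 -/

import Mathlib

open MeasureTheory
open scoped ContDiff RealInnerProductSpace

noncomputable section

namespace EllipticControl

variable {d : ℕ}

/-- `L²(Ω)`, real valued. -/
abbrev L2 (Ω : Set (EuclideanSpace ℝ (Fin d))) : Type :=
  Lp ℝ 2 (volume.restrict Ω)

/-- `[L²(Ω)]^d`. -/
abbrev L2Vec (Ω : Set (EuclideanSpace ℝ (Fin d))) : Type :=
  Lp (EuclideanSpace ℝ (Fin d)) 2 (volume.restrict Ω)

/-- `φ ∈ C_c^∞(Ω)`. -/
structure IsTestFunction (Ω : Set (EuclideanSpace ℝ (Fin d)))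
    (φ : EuclideanSpace ℝ (Fin d) → ℝ) : Prop where
  smooth : ContDiff ℝ ∞ φ
  compact : HasCompactSupport φ
  support_subset : tsupport φ ⊆ Ω

/-- The pairs `(φ, ∇φ)` in `L²(Ω) × [L²(Ω)]^d` with `φ ∈ C_c^∞(Ω)`. -/
def testPairs (Ω : Set (EuclideanSpace ℝ (Fin d))) : Set (WithLp 2 (L2 Ω × L2Vec Ω)) :=
  {z | ∃ φ : EuclideanSpace ℝ (Fin d) → ℝ, IsTestFunction Ω φ ∧
    (z.fst : EuclideanSpace ℝ (Fin d) → ℝ) =ᵐ[volume.restrict Ω] φ ∧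
    (z.snd : EuclideanSpace ℝ (Fin d) → EuclideanSpace ℝ (Fin d))
      =ᵐ[volume.restrict Ω] gradient φ}

/-- `H¹₀(Ω)`, the closure of `C_c^∞(Ω)` in the norm `(‖w‖² + ‖∇w‖²)^{1/2}`. An element is
stored as the pair `(w, ∇w)`; the second entry of a pair in the closure is the weak gradient
of the first one, hence determined by it. (The test pairs already form a linear subspace;
the span only packages this.) -/
def H10 (Ω : Set (EuclideanSpace ℝ (Fin d))) : Submodule ℝ (WithLp 2 (L2 Ω × L2Vec Ω)) :=
  (Submodule.span ℝ (testPairs Ω)).topologicalClosure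

/-- The function `w ∈ L²(Ω)` underlying `w ∈ H¹₀(Ω)`. -/
def toL2 {Ω : Set (EuclideanSpace ℝ (Fin d))} (w : H10 Ω) : L2 Ω :=
  (w : WithLp 2 (L2 Ω × L2Vec Ω)).fst

/-- The weak gradient `∇w ∈ [L²(Ω)]^d` of `w ∈ H¹₀(Ω)`. -/
def weakGrad {Ω : Set (EuclideanSpace ℝ (Fin d))} (w : H10 Ω) : L2Vec Ω :=
  (w : WithLp 2 (L2 Ω × L2Vec Ω)).snd

/-- `H(div, Ω)`: square integrable vector fields with a square integrable weak divergence
(which is determined by the field). -/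
structure HDivSpace (Ω : Set (EuclideanSpace ℝ (Fin d))) where
  field : L2Vec Ω
  div : L2 Ω
  integral_div_mul : ∀ φ : EuclideanSpace ℝ (Fin d) → ℝ, IsTestFunction Ω φ →
    ∫ x in Ω, div x * φ x = - ∫ x in Ω, ⟪field x, gradient φ x⟫

/-- `C > 0` is a constant in the Friedrichs inequality `‖w‖ ≤ C ‖∇w‖` on `H¹₀(Ω)`. -/
def IsFriedrichsConstant (Ω : Set (EuclideanSpace ℝ (Fin d))) (C : ℝ) : Prop :=
  0 < C ∧ ∀ w : H10 Ω, ‖toL2 w‖ ≤ C * ‖weakGrad w‖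

/-- The data of the optimal control problem: the diffusion coefficient `ν` with its bounds
`0 < νlo ≤ ν ≤ νhi` a.e. in `Ω`, the regularization parameter `lam > 0`, the desired state
`yd`, the desired control `ud` and the source `f`. -/
structure ControlProblem (Ω : Set (EuclideanSpace ℝ (Fin d))) where
  ν : EuclideanSpace ℝ (Fin d) → ℝ
  νlo : ℝ
  νhi : ℝ
  lam : ℝ
  yd : L2 Ω
  ud : L2 Ω
  f : L2 Ω
  aemeasurable_ν : AEMeasurable ν (volume.restrict Ω)
  νlo_pos : 0 < νlo
  ν_bounds : ∀ᵐ x ∂(volume.restrict Ω), νlo ≤ ν x ∧ ν x ≤ νhi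
  lam_pos : 0 < lam

namespace ControlProblem

variable {Ω : Set (EuclideanSpace ℝ (Fin d))} (P : ControlProblem Ω)

theorem memLp_smul (g : L2Vec Ω) :
    MemLp (fun x => P.ν x • g x) 2 (volume.restrict Ω) := by
  refine MemLp.of_le_mul (c := P.νhi) (Lp.memLp g)
    (P.aemeasurable_ν.aestronglyMeasurable.smul (Lp.aestronglyMeasurable g)) ?_
  filter_upwards [P.ν_bounds] with x hx
  have h0 : 0 ≤ P.ν x := P.νlo_pos.le.trans hx.1
  rw [norm_smul, Real.norm_of_nonneg h0]
  exact mul_le_mul_of_nonneg_right hx.2 (norm_nonneg _)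

/-- The product `ν g ∈ [L²(Ω)]^d`. -/
def nuMul (g : L2Vec Ω) : L2Vec Ω := (P.memLp_smul g).toLp _

/-- `y ∈ H¹₀(Ω)` is a weak solution of `-div (ν ∇y) = f + v` in `Ω`, `y = 0` on `∂Ω`. -/
def IsState (v : L2 Ω) (y : H10 Ω) : Prop :=
  ∀ w : H10 Ω, ⟪P.nuMul (weakGrad y), weakGrad w⟫ = ⟪P.f + v, toL2 w⟫

/-- The state `y(v)`: the solution of the state equation with control `v`. -/
def state (v : L2 Ω) : H10 Ω := Classical.epsilon (P.IsState v)

/-- The cost functional `𝒥(y, v) = ½ ‖y - y_d‖² + (λ/2) ‖v - u_d‖²`. -/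
def cost (y : H10 Ω) (v : L2 Ω) : ℝ :=
  1 / 2 * ‖toL2 y - P.yd‖ ^ 2 + P.lam / 2 * ‖v - P.ud‖ ^ 2

/-- `u` is an optimal control for `U_ad = L²(Ω)`. -/
def IsOptimalControl (u : L2 Ω) : Prop :=
  ∀ v : L2 Ω, P.cost (P.state u) u ≤ P.cost (P.state v) v

/-- The squared combined error `|||u - v|||² = ½ ‖y(u) - y(v)‖² + (λ/2) ‖u - v‖²`. -/
def errorSq (u v : L2 Ω) : ℝ :=
  1 / 2 * ‖toL2 (P.state u) - toL2 (P.state v)‖ ^ 2 + P.lam / 2 * ‖u - v‖ ^ 2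

/-- The control `v_ζ = u_d - ζ/λ`. -/
def controlOf (ζ : H10 Ω) : L2 Ω := P.ud - (1 / P.lam) • toL2 ζ

/-- The unconstrained cost majorant `𝒥⊕(α, β; η, ζ, τ)`, with Friedrichs constant `C`. -/
def costMajorant (C α β : ℝ) (η ζ : H10 Ω) (τ : HDivSpace Ω) : ℝ :=
  (1 + α) / 2 * ‖toL2 η - P.yd‖ ^ 2
  + (1 + α) * (1 + β) * C ^ 2 / (2 * α * P.νlo ^ 2) * ‖τ.field - P.nuMul (weakGrad η)‖ ^ 2
  + (1 + α) * (1 + β) * C ^ 4 / (2 * α * β * P.νlo ^ 2)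
    * ‖P.f + P.ud - (1 / P.lam) • toL2 ζ + τ.div‖ ^ 2
  + 1 / (2 * P.lam) * ‖toL2 ζ‖ ^ 2

/-- The unconstrained cost minorant `𝒥⊖(η, ζ, τ, ρ)`, with Friedrichs constant `C`. -/
def costMinorant (C : ℝ) (η ζ : H10 Ω) (τ ρ : HDivSpace Ω) : ℝ :=
  1 / 2 * ‖toL2 η - P.yd‖ ^ 2
  + 1 / (2 * P.lam) * ‖toL2 ζ‖ ^ 2
  + ⟪P.f + P.ud - (1 / P.lam) • toL2 ζ + τ.div, toL2 ζ⟫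
  + ⟪τ.field - P.nuMul (weakGrad η), weakGrad ζ⟫
  - 1 / P.νlo
    * (C * ‖toL2 η - P.yd + ρ.div‖ + ‖ρ.field - P.nuMul (weakGrad ζ)‖)
    * (C ^ 3 / (P.lam * P.νlo) * ‖toL2 η - P.yd + ρ.div‖
      + C ^ 2 / (P.lam * P.νlo) * ‖ρ.field - P.nuMul (weakGrad ζ)‖
      + C * ‖P.f + P.ud - (1 / P.lam) • toL2 ζ + τ.div‖
      + ‖τ.field - P.nuMul (weakGrad η)‖)

/-- The error majorant `ℳ⊕ = 𝒥⊕ - 𝒥⊖`. -/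
def errorMajorant (C α β : ℝ) (η ζ : H10 Ω) (τ ρ : HDivSpace Ω) : ℝ :=
  P.costMajorant C α β η ζ τ - P.costMinorant C η ζ τ ρ

end ControlProblem

end EllipticControl

end

open EllipticControl

/-! Coercivity, obtained from the Friedrichs inequality, makes the state an affine bounded function
of the control, so the reduced cost is a Tikhonov functional. Such a functional has a minimizer `u`,
and completing the square gives the exact identity `cost(v) = cost(u) + |||u - v|||²`. This makes
`u` the unique optimum and turns the error of `v_ζ` into the gap `cost(v_ζ) - cost(u)`. It remains
to bound the first cost above by `𝒥⊕` and the second below by `𝒥⊖`.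

Both bounds rest on the residual estimate `IsState.norm_weakGrad_sub_le`. Above, it controls `y(v_ζ)
- η`, and Young's inequality is applied twice. Below, the cost is expanded about `(η, v_ζ)`; the
state equation and div-grad duality turn the linear terms into computable ones plus adjoint
residuals paired with `y - η`. The unknown `‖v - v_ζ‖` that then enters is absorbed by the quadratic
term of the cost. -/

namespace EllipticControl

/-! ### Coercive operators and Tikhonov functionals in Hilbert space -/

section Hilbert

variable {V W : Type*} [NormedAddCommGroup V] [InnerProductSpace ℝ V] [CompleteSpace V]
  [NormedAddCommGroup W] [InnerProductSpace ℝ W] [CompleteSpace W]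

/-- A coercive bounded operator on a Hilbert space has a bounded two-sided inverse. -/
theorem exists_inverse_of_coercive (A : V →L[ℝ] V) {c : ℝ} (hc : 0 < c)
    (h : ∀ v, c * ‖v‖ ^ 2 ≤ ⟪A v, v⟫) :
    ∃ B : V →L[ℝ] V, (∀ v, A (B v) = v) ∧ ∀ v, B (A v) = v := by
  obtain ⟨U, hU⟩ := ContinuousLinearMap.isUnit_of_forall_le_norm_inner_map A (c := ⟨c, hc.le⟩)
    (by exact_mod_cast hc) (fun v => by
      rw [mul_comm]; exact (h v).trans (le_abs_self _))
  refine ⟨(↑U⁻¹ : V →L[ℝ] V), fun v => ?_, fun v => ?_⟩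
  · rw [← hU, ← mul_apply_eq_comp, U.mul_inv, one_apply_eq_self]
  · rw [← hU, ← mul_apply_eq_comp, U.inv_mul, one_apply_eq_self]

/-- A Tikhonov functional has a minimizer, around which it is exactly quadratic. -/
theorem exists_tikhonov_minimizer (T : V →L[ℝ] W) (c : W) (u₀ : V) {lam : ℝ} (hlam : 0 < lam) :
    ∃ u, ∀ v, 1 / 2 * ‖T v + c‖ ^ 2 + lam / 2 * ‖v - u₀‖ ^ 2
      = 1 / 2 * ‖T u + c‖ ^ 2 + lam / 2 * ‖u - u₀‖ ^ 2
        + (1 / 2 * ‖T (u - v)‖ ^ 2 + lam / 2 * ‖u - v‖ ^ 2) := by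
  let A : V →L[ℝ] V := T.adjoint ∘L T + lam • ContinuousLinearMap.id ℝ V
  have hA : ∀ u, A u = T.adjoint (T u) + lam • u := fun u => rfl
  obtain ⟨B, hB, -⟩ := exists_inverse_of_coercive A hlam (fun v => by
    rw [hA, inner_add_left, ContinuousLinearMap.adjoint_inner_left, real_inner_smul_left,
      real_inner_self_eq_norm_sq, real_inner_self_eq_norm_sq]
    nlinarith [sq_nonneg ‖T v‖])
  refine ⟨B (lam • u₀ - T.adjoint c), fun v => ?_⟩
  have hu := hB (lam • u₀ - T.adjoint c)
  set u := B (lam • u₀ - T.adjoint c)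
  -- The Euler–Lagrange equation `T*(T u + c) + lam (u - u₀) = 0`, tested with `u - v`; it kills the
  -- cross terms in the expansion about `u`.
  have h0 : ⟪T u + c, T (u - v)⟫ + lam * ⟪u - u₀, u - v⟫ = 0 := by
    have : T.adjoint (T u + c) + lam • (u - u₀) = 0 := by
      rw [hA, eq_sub_iff_add_eq] at hu
      rw [map_add, smul_sub, ← sub_eq_zero.mpr hu]
      abel
    rw [← ContinuousLinearMap.adjoint_inner_left, ← real_inner_smul_left, ← inner_add_left, this,
      inner_zero_left]
  have e1 : T v + c = (T u + c) - T (u - v) := by rw [map_sub]; abel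
  have e2 : v - u₀ = (u - u₀) - (u - v) := by abel
  rw [e1, e2, norm_sub_sq_real, norm_sub_sq_real]
  linear_combination -h0

end Hilbert

/-! ### Friedrichs inequality and density in `H¹₀(Ω)` -/

variable {d : ℕ} {Ω : Set (EuclideanSpace ℝ (Fin d))}

theorem inner_gradient_eq_fderiv {φ : EuclideanSpace ℝ (Fin d) → ℝ}
    (x e : EuclideanSpace ℝ (Fin d)) : ⟪gradient φ x, e⟫ = fderiv ℝ φ x e := by
  simp [gradient]

/-- Integration by parts against the field `x ↦ ⟪x, e⟫ e`, for a test function squared. -/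
theorem IsTestFunction.integral_mul_self {φ : EuclideanSpace ℝ (Fin d) → ℝ}
    (hφ : IsTestFunction Ω φ) {e : EuclideanSpace ℝ (Fin d)} (he : ‖e‖ = 1) :
    ∫ x in Ω, φ x * φ x = ∫ x in Ω, φ x * (-2 * ⟪x, e⟫ * ⟪gradient φ x, e⟫) := by
  have hzero : ∀ x, x ∉ Ω → φ x = 0 := fun x hx =>
    image_eq_zero_of_notMem_tsupport fun h => hx (hφ.support_subset h)
  rw [setIntegral_eq_integral_of_forall_compl_eq_zero (fun x hx => by simp [hzero x hx]),
    setIntegral_eq_integral_of_forall_compl_eq_zero (fun x hx => by simp [hzero x hx])]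
  have hd : Differentiable ℝ φ := hφ.smooth.differentiable (by simp)
  have hc : Continuous φ := hφ.smooth.continuous
  have hc' : Continuous fun x => fderiv ℝ φ x e :=
    (hφ.smooth.continuous_fderiv (by simp)).clm_apply continuous_const
  have hf : ∀ x, HasFDerivAt (fun x : EuclideanSpace ℝ (Fin d) => ⟪e, x⟫) (innerSL ℝ e) x :=
    fun x => (innerSL ℝ e).hasFDerivAt
  have hf' : ∀ x, fderiv ℝ (fun x : EuclideanSpace ℝ (Fin d) => ⟪e, x⟫) x e = 1 := fun x => by
    rw [(hf x).fderiv]; simp [he]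
  have hg' : ∀ x, fderiv ℝ (fun x => φ x * φ x) x e = 2 * (φ x * fderiv ℝ φ x e) := fun x => by
    rw [fderiv_fun_mul (hd x) (hd x)]; simp; ring
  have hs : ∀ h : EuclideanSpace ℝ (Fin d) → ℝ, Continuous h →
      Integrable (fun x => φ x * h x) := fun h hh =>
    (hc.mul hh).integrable_of_hasCompactSupport hφ.compact.mul_right
  -- The linear function `⟪e, x⟫` has derivative 1 along `e`. On the whole space no boundary term
  -- appears, since `φ²` has compact support.
  have key := integral_mul_fderiv_eq_neg_fderiv_mul_of_integrable (μ := volume)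
    (f := fun x : EuclideanSpace ℝ (Fin d) => ⟪e, x⟫) (g := fun x => φ x * φ x) (v := e)
    (by simpa only [hf', one_mul] using hs φ hc)
    (by
      simp only [hg']
      refine (hs (fun x => ⟪e, x⟫ * (2 * fderiv ℝ φ x e)) (by fun_prop)).congr (.of_forall ?_)
      intro x; simp only; ring)
    (by
      refine (hs (fun x => ⟪e, x⟫ * φ x) (by fun_prop)).congr (.of_forall ?_)
      intro x; simp only; ring)
    (fun x _ => (hf x).differentiableAt) (fun x _ => (hd x).mul (hd x))
  simp only [hf', hg', one_mul] at key
  rw [eq_comm, neg_eq_iff_eq_neg] at key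
  rw [key, ← integral_neg]
  refine integral_congr_ae (.of_forall fun x => ?_)
  simp only [inner_gradient_eq_fderiv, real_inner_comm e x]
  ring

/-- The Friedrichs inequality for test functions on a bounded set. -/
theorem norm_fst_le_of_mem_testPairs (hd : 1 ≤ d) (hΩ : MeasurableSet Ω) {R : ℝ}
    (hR : ∀ x ∈ Ω, ‖x‖ ≤ R) {z : WithLp 2 (L2 Ω × L2Vec Ω)} (hz : z ∈ testPairs Ω) :
    ‖z.fst‖ ≤ 2 * R * ‖z.snd‖ := by
  obtain ⟨φ, hφ, h1, h2⟩ := hz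
  set e : EuclideanSpace ℝ (Fin d) := EuclideanSpace.single ⟨0, hd⟩ 1 with he_def
  have he : ‖e‖ = 1 := by simp [he_def]
  have hbound : ∀ᵐ x ∂(volume.restrict Ω),
      ‖-2 * ⟪x, e⟫ * ⟪z.snd x, e⟫‖ ≤ 2 * R * ‖z.snd x‖ := by
    filter_upwards [ae_restrict_mem hΩ] with x hx
    have hx1 := abs_real_inner_le_norm x e
    have hx2 := abs_real_inner_le_norm (z.snd x) e
    rw [he, mul_one] at hx1 hx2
    rw [Real.norm_eq_abs, abs_mul, abs_mul]
    have : |(-2 : ℝ)| = 2 := by norm_num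
    rw [this]
    have hR0 : 0 ≤ R := (norm_nonneg x).trans (hR x hx)
    have := hx1.trans (hR x hx)
    gcongr
  have hmeas : AEStronglyMeasurable (fun x => -2 * ⟪x, e⟫ * ⟪z.snd x, e⟫)
      (volume.restrict Ω) :=
    (by fun_prop : Continuous fun x : EuclideanSpace ℝ (Fin d) =>
      -2 * ⟪x, e⟫).aestronglyMeasurable.mul
      ((Lp.aestronglyMeasurable z.snd).inner aestronglyMeasurable_const)
  have hmem : MemLp (fun x => -2 * ⟪x, e⟫ * ⟪z.snd x, e⟫) 2 (volume.restrict Ω) :=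
    MemLp.of_le_mul (Lp.memLp z.snd) hmeas hbound
  have hG : ‖hmem.toLp‖ ≤ 2 * R * ‖z.snd‖ := by
    apply Lp.norm_le_mul_norm_of_ae_le_mul
    filter_upwards [hmem.coeFn_toLp, hbound] with x h3 h4
    rwa [h3]
  -- Cauchy–Schwarz on this identity leaves one factor `‖z.fst‖` to cancel; the factor `|⟪x, e⟫| ≤
  -- R` is the source of the constant `2R`.
  have hself : ⟪z.fst, z.fst⟫ = ⟪z.fst, hmem.toLp⟫ := by
    have e1 : ⟪z.fst, z.fst⟫ = ∫ x in Ω, φ x * φ x := by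
      rw [L2.inner_def]
      refine integral_congr_ae ?_
      filter_upwards [h1] with x hx
      rw [hx]; simp only [RCLike.inner_apply, conj_trivial]
    have e2 : ⟪z.fst, hmem.toLp⟫
        = ∫ x in Ω, φ x * (-2 * ⟪x, e⟫ * ⟪gradient φ x, e⟫) := by
      rw [L2.inner_def]
      refine integral_congr_ae ?_
      filter_upwards [h1, h2, hmem.coeFn_toLp] with x hx hx2 hx3
      rw [hx3, hx, hx2]
      simp only [RCLike.inner_apply, conj_trivial]
      ring
    rw [e1, e2, hφ.integral_mul_self he]
  rcases (norm_nonneg z.fst).eq_or_lt with h0 | h0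
  · rw [← h0]; exact (norm_nonneg _).trans hG
  · refine le_trans (le_of_mul_le_mul_left ?_ h0) hG
    rw [← real_inner_self_eq_norm_mul_norm, hself]
    exact real_inner_le_norm _ _

/-- Lets density arguments use conditions that are not linear, such as the Friedrichs inequality, by
checking them on test pairs alone. -/
theorem span_testPairs : (Submodule.span ℝ (testPairs Ω) : Set _) = testPairs Ω := by
  refine Set.Subset.antisymm (fun z hz => ?_) Submodule.subset_span
  induction hz using Submodule.span_induction with
  | mem z hz => exact hz
  | zero =>
    refine ⟨fun _ => 0, ⟨contDiff_const, HasCompactSupport.zero, ?_⟩, ?_, ?_⟩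
    · simp [tsupport]
    · exact Lp.coeFn_zero ℝ 2 (volume.restrict Ω)
    · filter_upwards [Lp.coeFn_zero (EuclideanSpace ℝ (Fin d)) 2 (volume.restrict Ω)] with x hx
      rw [WithLp.zero_snd, hx]
      simp [gradient]
  | add z w _ _ hz hw =>
    obtain ⟨φ, hφ, h1, h2⟩ := hz
    obtain ⟨ψ, hψ, h3, h4⟩ := hw
    refine ⟨φ + ψ, ⟨hφ.smooth.add hψ.smooth, hφ.compact.add hψ.compact,
      (tsupport_add φ ψ).trans (Set.union_subset hφ.support_subset hψ.support_subset)⟩, ?_, ?_⟩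
    · filter_upwards [Lp.coeFn_add z.fst w.fst, h1, h3] with x hx hx1 hx3
      rw [WithLp.add_fst, hx, Pi.add_apply, Pi.add_apply, hx1, hx3]
    · filter_upwards [Lp.coeFn_add z.snd w.snd, h2, h4] with x hx hx1 hx3
      rw [WithLp.add_snd, hx, Pi.add_apply, hx1, hx3]
      simp only [gradient]
      rw [fderiv_add (hφ.smooth.differentiable (by simp) x)
        (hψ.smooth.differentiable (by simp) x), map_add]
  | smul a z _ hz =>
    obtain ⟨φ, hφ, h1, h2⟩ := hz
    refine ⟨a • φ, ⟨hφ.smooth.const_smul a, hφ.compact.smul_left,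
      (tsupport_smul_subset_right (fun _ => a) φ).trans hφ.support_subset⟩, ?_, ?_⟩
    · filter_upwards [Lp.coeFn_smul a z.fst, h1] with x hx hx1
      rw [WithLp.smul_fst, hx, Pi.smul_apply, Pi.smul_apply, hx1]
    · filter_upwards [Lp.coeFn_smul a z.snd, h2] with x hx hx1
      rw [WithLp.smul_snd, hx, Pi.smul_apply, hx1]
      simp only [gradient]
      rw [fderiv_const_smul (hφ.smooth.differentiable (by simp) x), map_smulₛₗ]
      simp

/-- A closed condition holding for all test pairs holds on `H¹₀(Ω)`. -/
theorem H10_induction {p : WithLp 2 (L2 Ω × L2Vec Ω) → Prop} (hp : IsClosed {z | p z})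
    (h : ∀ z ∈ testPairs Ω, p z) (w : H10 Ω) : p w := by
  have hw : (w : WithLp 2 (L2 Ω × L2Vec Ω)) ∈
      ((Submodule.span ℝ (testPairs Ω)).topologicalClosure : Set _) := w.2
  rw [Submodule.topologicalClosure_coe, span_testPairs] at hw
  exact closure_minimal h hp hw

theorem exists_isFriedrichsConstant (hd : 1 ≤ d) (hΩ : MeasurableSet Ω)
    (hb : Bornology.IsBounded Ω) : ∃ C : ℝ, IsFriedrichsConstant Ω C := by
  obtain ⟨R, hR0, hR⟩ := hb.exists_pos_norm_le
  refine ⟨2 * R, by positivity, fun w => ?_⟩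
  refine H10_induction (p := fun z => ‖z.fst‖ ≤ 2 * R * ‖z.snd‖) ?_
    (fun z hz => norm_fst_le_of_mem_testPairs hd hΩ hR hz) w
  exact isClosed_le (WithLp.fstL 2 ℝ (L2 Ω) (L2Vec Ω)).continuous.norm
    (continuous_const.mul (WithLp.sndL 2 ℝ (L2 Ω) (L2Vec Ω)).continuous.norm)

/-- The weak divergence is dual to the weak gradient on `H¹₀(Ω)`. -/
theorem HDivSpace.inner_div_add_inner_field (τ : HDivSpace Ω) (w : H10 Ω) :
    ⟪τ.div, toL2 w⟫ + ⟪τ.field, weakGrad w⟫ = 0 := by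
  refine H10_induction (p := fun z => ⟪τ.div, z.fst⟫ + ⟪τ.field, z.snd⟫ = 0) ?_ ?_ w
  · exact isClosed_eq
      ((continuous_const.inner (WithLp.fstL 2 ℝ (L2 Ω) (L2Vec Ω)).continuous).add
        (continuous_const.inner (WithLp.sndL 2 ℝ (L2 Ω) (L2Vec Ω)).continuous)) continuous_const
  · rintro z ⟨φ, hφ, h1, h2⟩
    have e1 : ⟪τ.div, z.fst⟫ = ∫ x in Ω, τ.div x * φ x := by
      rw [L2.inner_def]
      refine integral_congr_ae ?_
      filter_upwards [h1] with x hx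
      rw [hx]; simp only [RCLike.inner_apply, conj_trivial]; ring
    have e2 : ⟪τ.field, z.snd⟫ = ∫ x in Ω, ⟪τ.field x, gradient φ x⟫ := by
      rw [L2.inner_def]
      refine integral_congr_ae ?_
      filter_upwards [h2] with x hx
      rw [hx]
    rw [e1, e2, τ.integral_div_mul φ hφ, neg_add_cancel]

instance : CompleteSpace (H10 Ω) :=
  (Submodule.isClosed_topologicalClosure (Submodule.span ℝ (testPairs Ω))).completeSpace_coe

/-- The embedding `H¹₀(Ω) → L²(Ω)` as a bounded operator. -/
noncomputable def toL2L (Ω : Set (EuclideanSpace ℝ (Fin d))) : H10 Ω →L[ℝ] L2 Ω :=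
  (WithLp.fstL 2 ℝ (L2 Ω) (L2Vec Ω)) ∘L (H10 Ω).subtypeL

/-- The weak gradient as a bounded operator on `H¹₀(Ω)`. -/
noncomputable def weakGradL (Ω : Set (EuclideanSpace ℝ (Fin d))) : H10 Ω →L[ℝ] L2Vec Ω :=
  (WithLp.sndL 2 ℝ (L2 Ω) (L2Vec Ω)) ∘L (H10 Ω).subtypeL

theorem toL2L_apply (w : H10 Ω) : toL2L Ω w = toL2 w := rfl

theorem toL2_sub (w z : H10 Ω) : toL2 (w - z) = toL2 w - toL2 z := rfl

theorem weakGrad_sub (w z : H10 Ω) : weakGrad (w - z) = weakGrad w - weakGrad z := rfl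

theorem norm_sq_H10 (w : H10 Ω) : ‖w‖ ^ 2 = ‖toL2 w‖ ^ 2 + ‖weakGrad w‖ ^ 2 :=
  WithLp.prod_norm_sq_eq_of_L2 (w : WithLp 2 (L2 Ω × L2Vec Ω))

/-! ### The diffusion operator and the state equation -/

namespace ControlProblem

variable (P : ControlProblem Ω)

theorem coeFn_nuMul (g : L2Vec Ω) :
    P.nuMul g =ᵐ[volume.restrict Ω] fun x => P.ν x • g x := (P.memLp_smul g).coeFn_toLp

theorem nuMul_add (g h : L2Vec Ω) : P.nuMul (g + h) = P.nuMul g + P.nuMul h := by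
  apply Lp.ext
  filter_upwards [P.coeFn_nuMul (g + h), P.coeFn_nuMul g, P.coeFn_nuMul h, Lp.coeFn_add g h,
    Lp.coeFn_add (P.nuMul g) (P.nuMul h)] with x h1 h2 h3 h4 h5
  rw [h1, h5, Pi.add_apply, h2, h3, h4, Pi.add_apply, smul_add]

theorem nuMul_smul (a : ℝ) (g : L2Vec Ω) : P.nuMul (a • g) = a • P.nuMul g := by
  apply Lp.ext
  filter_upwards [P.coeFn_nuMul (a • g), P.coeFn_nuMul g, Lp.coeFn_smul a g,
    Lp.coeFn_smul a (P.nuMul g)] with x h1 h2 h3 h4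
  rw [h1, h4, Pi.smul_apply, h2, h3, Pi.smul_apply, smul_comm]

theorem norm_nuMul_le (g : L2Vec Ω) : ‖P.nuMul g‖ ≤ P.νhi * ‖g‖ := by
  apply Lp.norm_le_mul_norm_of_ae_le_mul
  filter_upwards [P.coeFn_nuMul g, P.ν_bounds] with x h1 h2
  rw [h1, norm_smul, Real.norm_of_nonneg (P.νlo_pos.le.trans h2.1)]
  exact mul_le_mul_of_nonneg_right h2.2 (norm_nonneg _)

/-- Multiplication by `ν` as a bounded operator. -/
noncomputable def nuMulL : L2Vec Ω →L[ℝ] L2Vec Ω :=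
  LinearMap.mkContinuous
    { toFun := P.nuMul, map_add' := P.nuMul_add, map_smul' := P.nuMul_smul } P.νhi
    P.norm_nuMul_le

theorem nuMul_sub (g h : L2Vec Ω) : P.nuMul (g - h) = P.nuMul g - P.nuMul h :=
  map_sub P.nuMulL g h

theorem le_inner_nuMul_self (g : L2Vec Ω) : P.νlo * ‖g‖ ^ 2 ≤ ⟪P.nuMul g, g⟫ := by
  rw [← real_inner_self_eq_norm_sq, L2.inner_def, L2.inner_def, ← integral_const_mul]
  refine integral_mono_ae ((L2.integrable_inner g g).const_mul _)
    (L2.integrable_inner (P.nuMul g) g) ?_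
  filter_upwards [P.coeFn_nuMul g, P.ν_bounds] with x h1 h2
  rw [h1, real_inner_smul_left]
  exact mul_le_mul_of_nonneg_right h2.1 real_inner_self_nonneg

theorem inner_nuMul_comm (g h : L2Vec Ω) : ⟪P.nuMul g, h⟫ = ⟪P.nuMul h, g⟫ := by
  rw [L2.inner_def, L2.inner_def]
  refine integral_congr_ae ?_
  filter_upwards [P.coeFn_nuMul g, P.coeFn_nuMul h] with x h1 h2
  rw [h1, h2, real_inner_smul_left, real_inner_smul_left, real_inner_comm]

/-- The solution operator `g ↦ y` of `-div (ν ∇y) = g`. -/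
theorem exists_solutionOperator {C : ℝ} (hC : IsFriedrichsConstant Ω C) :
    ∃ S : L2 Ω →L[ℝ] H10 Ω, ∀ (v : L2 Ω) (y : H10 Ω), P.IsState v y ↔ y = S (P.f + v) := by
  obtain ⟨A, hA⟩ : ∃ A : H10 Ω →L[ℝ] H10 Ω,
      ∀ y w, ⟪A y, w⟫ = ⟪P.nuMul (weakGrad y), weakGrad w⟫ :=
    ⟨(weakGradL Ω).adjoint ∘L P.nuMulL ∘L weakGradL Ω, fun y w =>
      ContinuousLinearMap.adjoint_inner_left (weakGradL Ω) w _⟩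
  -- The coercivity constant comes from `‖w‖² + ‖∇w‖² ≤ (1 + C²) ‖∇w‖²`.
  obtain ⟨B, hAB, hBA⟩ := exists_inverse_of_coercive A (c := P.νlo / (1 + C ^ 2))
    (div_pos P.νlo_pos (by positivity)) (fun w => by
      rw [hA]
      refine le_trans ?_ (P.le_inner_nuMul_self _)
      rw [div_mul_eq_mul_div, div_le_iff₀ (by positivity), mul_assoc]
      refine mul_le_mul_of_nonneg_left ?_ P.νlo_pos.le
      have := pow_le_pow_left₀ (norm_nonneg _) (hC.2 w) 2
      rw [norm_sq_H10]
      nlinarith)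
  refine ⟨B ∘L (toL2L Ω).adjoint, fun v y => ?_⟩
  have h1 : P.IsState v y ↔ A y = (toL2L Ω).adjoint (P.f + v) := by
    rw [ext_iff_inner_right ℝ]
    simp only [hA, ContinuousLinearMap.adjoint_inner_left, toL2L_apply, IsState]
  rw [h1, ContinuousLinearMap.comp_apply]
  exact ⟨fun h => by rw [← h, hBA], fun h => by rw [h, hAB]⟩

/-! ### Residual estimate and two-sided cost bounds -/

variable {P}

/-- The distance of the state to an arbitrary `η`, bounded by residuals. -/
theorem IsState.norm_weakGrad_sub_le {C : ℝ} (hC : IsFriedrichsConstant Ω C) {v : L2 Ω}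
    {y : H10 Ω} (hy : P.IsState v y) (η : H10 Ω) (τ : HDivSpace Ω) :
    ‖weakGrad (y - η)‖ ≤
      1 / P.νlo * (C * ‖P.f + v + τ.div‖ + ‖τ.field - P.nuMul (weakGrad η)‖) := by
  rw [one_div, le_inv_mul_iff₀ P.νlo_pos]
  have hτ := τ.inner_div_add_inner_field (y - η)
  -- The state equation tested with `y - η`, with the vanishing duality pairing of `τ` added.
  have h1 : ⟪P.nuMul (weakGrad (y - η)), weakGrad (y - η)⟫ =
      ⟪P.f + v + τ.div, toL2 (y - η)⟫
        + ⟪τ.field - P.nuMul (weakGrad η), weakGrad (y - η)⟫ := by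
    have := hy (y - η)
    rw [inner_add_left, inner_sub_left, ← this, weakGrad_sub y η, P.nuMul_sub, inner_sub_left,
      ← weakGrad_sub]
    linear_combination -hτ
  have h2 := P.le_inner_nuMul_self (weakGrad (y - η))
  have h3 := real_inner_le_norm (P.f + v + τ.div) (toL2 (y - η))
  have h4 := real_inner_le_norm (τ.field - P.nuMul (weakGrad η)) (weakGrad (y - η))
  have h5 := mul_le_mul_of_nonneg_left (hC.2 (y - η)) (norm_nonneg (P.f + v + τ.div))
  rcases (norm_nonneg (weakGrad (y - η))).eq_or_lt with h0 | h0
  · rw [← h0, mul_zero]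
    have := hC.1
    positivity
  · refine le_of_mul_le_mul_right ?_ h0
    rw [h1] at h2
    linarith

theorem controlOf_sub_ud (ζ : H10 Ω) : P.controlOf ζ - P.ud = -((1 / P.lam) • toL2 ζ) := by
  rw [controlOf]; abel

/-- Identifies `r` as the equilibrium residual of the state equation with control `v_ζ`. -/
theorem f_add_controlOf (ζ : H10 Ω) :
    P.f + P.controlOf ζ = P.f + P.ud - (1 / P.lam) • toL2 ζ := by
  rw [controlOf]; abel

/-- The cost of `v_ζ` is bounded by the cost majorant. -/
theorem cost_controlOf_le_costMajorant {C : ℝ} (hC : IsFriedrichsConstant Ω C) {ζ y : H10 Ω}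
    (hy : P.IsState (P.controlOf ζ) y) (η : H10 Ω) (τ : HDivSpace Ω) {α β : ℝ} (hα : 0 < α)
    (hβ : 0 < β) : P.cost y (P.controlOf ζ) ≤ P.costMajorant C α β η ζ τ := by
  have hlam := P.lam_pos
  have hν := P.νlo_pos
  have hE := hy.norm_weakGrad_sub_le hC η τ
  rw [f_add_controlOf] at hE
  rw [cost, costMajorant, controlOf_sub_ud, norm_neg, norm_smul,
    Real.norm_of_nonneg (by positivity)]
  set r := ‖P.f + P.ud - (1 / P.lam) • toL2 ζ + τ.div‖
  set s := ‖τ.field - P.nuMul (weakGrad η)‖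
  have hr0 : 0 ≤ r := norm_nonneg _
  have hs0 : 0 ≤ s := norm_nonneg _
  have hC0 := hC.1
  have h1 : ‖toL2 (y - η)‖ ≤ C * (1 / P.νlo * (C * r + s)) :=
    (hC.2 _).trans (mul_le_mul_of_nonneg_left hE hC0.le)
  have h2 : ‖toL2 y - P.yd‖ ≤ ‖toL2 η - P.yd‖ + C * (1 / P.νlo * (C * r + s)) := by
    have : toL2 y - P.yd = (toL2 η - P.yd) + toL2 (y - η) := by rw [toL2_sub]; abel
    rw [this]
    exact (norm_add_le _ _).trans (by gcongr)
  -- Used with `t = α` to separate `η - y_d` from the state error, then with `t = β` to separate `s`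
  -- from `C r`.
  have young : ∀ a b t : ℝ, 0 < t → (a + b) ^ 2 ≤ (1 + t) * a ^ 2 + (1 + t) / t * b ^ 2 := by
    intro a b t ht
    have : (1 + t) * a ^ 2 + (1 + t) / t * b ^ 2 - (a + b) ^ 2 = (t * a - b) ^ 2 / t := by
      field_simp; ring
    have : 0 ≤ (t * a - b) ^ 2 / t := by positivity
    linarith
  have h3 := (pow_le_pow_left₀ (norm_nonneg _) h2 2).trans (young _ _ α hα)
  have h4 := young s (C * r) β hβ
  have h5 : (1 + α) / α * (C * (1 / P.νlo * (C * r + s))) ^ 2 ≤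
      (1 + α) / α * (C / P.νlo) ^ 2 * ((1 + β) * s ^ 2 + (1 + β) / β * (C * r) ^ 2) := by
    have : (1 + α) / α * (C * (1 / P.νlo * (C * r + s))) ^ 2 =
      (1 + α) / α * (C / P.νlo) ^ 2 * (s + C * r) ^ 2 := by ring
    rw [this]
    exact mul_le_mul_of_nonneg_left h4 (by positivity)
  have h6 : P.lam / 2 * (1 / P.lam * ‖toL2 ζ‖) ^ 2 = 1 / (2 * P.lam) * ‖toL2 ζ‖ ^ 2 := by
    field_simp
  have h7 : 1 / 2 * ((1 + α) / α * (C / P.νlo) ^ 2 * ((1 + β) * s ^ 2 + (1 + β) / β * (C * r) ^ 2))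
      = (1 + α) * (1 + β) * C ^ 2 / (2 * α * P.νlo ^ 2) * s ^ 2
        + (1 + α) * (1 + β) * C ^ 4 / (2 * α * β * P.νlo ^ 2) * r ^ 2 := by
    field_simp
  rw [h6]
  linarith

/-- The cost of every control is bounded below by the cost minorant. -/
theorem costMinorant_le_cost {C : ℝ} (hC : IsFriedrichsConstant Ω C) {v : L2 Ω} {y : H10 Ω}
    (hy : P.IsState v y) (η ζ : H10 Ω) (τ ρ : HDivSpace Ω) :
    P.costMinorant C η ζ τ ρ ≤ P.cost y v := by
  have hlam := P.lam_pos
  have hν := P.νlo_pos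
  have hC0 := hC.1
  set e := y - η with he
  set q := v - P.controlOf ζ with hq
  have hE := hy.norm_weakGrad_sub_le hC η τ
  rw [← he] at hE
  have hr : P.f + v + τ.div = (P.f + P.ud - (1 / P.lam) • toL2 ζ + τ.div) + q := by
    rw [hq, controlOf]; abel
  have hrq : ‖P.f + v + τ.div‖ ≤ ‖P.f + P.ud - (1 / P.lam) • toL2 ζ + τ.div‖ + ‖q‖ := by
    rw [hr]; exact norm_add_le _ _
  -- The control part contributes `-⟪ζ, q⟫` because `λ (v_ζ - u_d) = -ζ`.
  have hcost : P.cost y v = 1 / 2 * ‖toL2 η - P.yd‖ ^ 2 + 1 / (2 * P.lam) * ‖toL2 ζ‖ ^ 2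
      + ⟪toL2 η - P.yd, toL2 e⟫ - ⟪toL2 ζ, q⟫
      + 1 / 2 * ‖toL2 e‖ ^ 2 + P.lam / 2 * ‖q‖ ^ 2 := by
    have e1 : toL2 y - P.yd = (toL2 η - P.yd) + toL2 e := by rw [he, toL2_sub]; abel
    have e2 : v - P.ud = -((1 / P.lam) • toL2 ζ) + q := by rw [hq, controlOf]; abel
    rw [cost, e1, e2, norm_add_sq_real, norm_add_sq_real, norm_neg, inner_neg_left,
      real_inner_smul_left, norm_smul, Real.norm_of_nonneg (by positivity)]
    field_simp
    ring
  have hτ := τ.inner_div_add_inner_field ζ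
  have hρ := ρ.inner_div_add_inner_field e
  -- Uses the state equation tested with `ζ`, symmetry of `ν`, and duality for `τ` against `ζ` and
  -- for `ρ` against `e`.
  have hlin : ⟪toL2 η - P.yd, toL2 e⟫ - ⟪toL2 ζ, q⟫ =
      ⟪P.f + P.ud - (1 / P.lam) • toL2 ζ + τ.div, toL2 ζ⟫
      + ⟪τ.field - P.nuMul (weakGrad η), weakGrad ζ⟫
      + ⟪toL2 η - P.yd + ρ.div, toL2 e⟫
      + ⟪ρ.field - P.nuMul (weakGrad ζ), weakGrad e⟫ := by
    have hsymm : ⟪P.nuMul (weakGrad ζ), weakGrad e⟫ = ⟪P.nuMul (weakGrad e), weakGrad ζ⟫ :=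
      P.inner_nuMul_comm _ _
    have hst := hy ζ
    have hye : P.nuMul (weakGrad e) = P.nuMul (weakGrad y) - P.nuMul (weakGrad η) := by
      rw [he, weakGrad_sub, P.nuMul_sub]
    have hr' : P.f + P.ud - (1 / P.lam) • toL2 ζ + τ.div = (P.f + v) + τ.div - q := by
      rw [hq, controlOf]; abel
    rw [hr', inner_sub_left (P.f + v + τ.div), inner_add_left (P.f + v), ← hst,
      inner_sub_left τ.field, inner_sub_left ρ.field, hsymm, hye,
      inner_sub_left (P.nuMul (weakGrad y)), inner_add_left (toL2 η - P.yd), real_inner_comm q]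
    linear_combination -hτ - hρ
  rw [hcost, costMinorant]
  set a := ‖toL2 η - P.yd + ρ.div‖
  set b := ‖ρ.field - P.nuMul (weakGrad ζ)‖
  set r := ‖P.f + P.ud - (1 / P.lam) • toL2 ζ + τ.div‖
  set s := ‖τ.field - P.nuMul (weakGrad η)‖
  have h1 : -(a * ‖toL2 e‖) ≤ ⟪toL2 η - P.yd + ρ.div, toL2 e⟫ :=
    neg_le_of_abs_le (abs_real_inner_le_norm _ _)
  have h2 : -(b * ‖weakGrad e‖) ≤ ⟪ρ.field - P.nuMul (weakGrad ζ), weakGrad e⟫ :=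
    neg_le_of_abs_le (abs_real_inner_le_norm _ _)
  have ha : 0 ≤ a := norm_nonneg _
  have hb : 0 ≤ b := norm_nonneg _
  have h3 : a * ‖toL2 e‖ ≤ a * (C * ‖weakGrad e‖) := mul_le_mul_of_nonneg_left (hC.2 e) ha
  have hE' : ‖weakGrad e‖ ≤ 1 / P.νlo * (C * (r + ‖q‖) + s) := hE.trans (by gcongr)
  have h4 : (C * a + b) * ‖weakGrad e‖ ≤ (C * a + b) * (1 / P.νlo * (C * (r + ‖q‖) + s)) :=
    mul_le_mul_of_nonneg_left hE' (by positivity)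
  -- Completing the square absorbs `‖q‖`. Half of the `C²(C a + b)²/(λ νlo²)` in the minorant would
  -- suffice; the rest is the second square below.
  have h5 : (C * a + b) * (1 / P.νlo * (C * (r + ‖q‖) + s))
      ≤ 1 / P.νlo * (C * a + b) * (C ^ 3 / (P.lam * P.νlo) * a + C ^ 2 / (P.lam * P.νlo) * b
        + C * r + s) + P.lam / 2 * ‖q‖ ^ 2 := by
    have : 1 / P.νlo * (C * a + b) * (C ^ 3 / (P.lam * P.νlo) * a + C ^ 2 / (P.lam * P.νlo) * b
        + C * r + s) + P.lam / 2 * ‖q‖ ^ 2 - (C * a + b) * (1 / P.νlo * (C * (r + ‖q‖) + s))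
        = ((C * (C * a + b) / P.νlo - P.lam * ‖q‖) ^ 2 + (C * (C * a + b) / P.νlo) ^ 2)
          / (2 * P.lam) := by
      field_simp
      ring
    have : 0 ≤ ((C * (C * a + b) / P.νlo - P.lam * ‖q‖) ^ 2 + (C * (C * a + b) / P.νlo) ^ 2)
          / (2 * P.lam) := by positivity
    linarith
  nlinarith [sq_nonneg ‖toL2 e‖]

end ControlProblem

end EllipticControl

/-! ### Optimality and the error majorant -/

theorem mainTheorem10 {d : ℕ} (hd : 1 ≤ d) (Ω : Set (EuclideanSpace ℝ (Fin d)))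
    (hΩo : IsOpen Ω) (hΩb : Bornology.IsBounded Ω) (P : ControlProblem Ω) :
    (∃ C : ℝ, IsFriedrichsConstant Ω C) ∧
    (∀ v : L2 Ω, ∃! y : H10 Ω, P.IsState v y) ∧
    (∃! u : L2 Ω, P.IsOptimalControl u) ∧
    ∀ u : L2 Ω, P.IsOptimalControl u →
    ∀ C : ℝ, IsFriedrichsConstant Ω C →
    ∀ (η ζ : H10 Ω) (τ ρ : HDivSpace Ω) (α β : ℝ), 0 < α → 0 < β →
      P.errorSq u (P.controlOf ζ) ≤ P.errorMajorant C α β η ζ τ ρ ∧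
      P.errorMajorant C α β η ζ τ ρ =
        α / 2 * ‖toL2 η - P.yd‖ ^ 2
        + (1 + α) * (1 + β) * C ^ 2 / (2 * α * P.νlo ^ 2) * ‖τ.field - P.nuMul (weakGrad η)‖ ^ 2
        + (1 + α) * (1 + β) * C ^ 4 / (2 * α * β * P.νlo ^ 2)
          * ‖P.f + P.ud - (1 / P.lam) • toL2 ζ + τ.div‖ ^ 2
        - ⟪P.f + P.ud - (1 / P.lam) • toL2 ζ + τ.div, toL2 ζ⟫
        - ⟪τ.field - P.nuMul (weakGrad η), weakGrad ζ⟫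
        + 1 / P.νlo
          * (C * ‖toL2 η - P.yd + ρ.div‖ + ‖ρ.field - P.nuMul (weakGrad ζ)‖)
          * (C ^ 3 / (P.lam * P.νlo) * ‖toL2 η - P.yd + ρ.div‖
            + C ^ 2 / (P.lam * P.νlo) * ‖ρ.field - P.nuMul (weakGrad ζ)‖
            + C * ‖P.f + P.ud - (1 / P.lam) • toL2 ζ + τ.div‖
            + ‖τ.field - P.nuMul (weakGrad η)‖) := by
  have hΩm : MeasurableSet Ω := hΩo.measurableSet
  obtain ⟨C₀, hC₀⟩ := exists_isFriedrichsConstant hd hΩm hΩb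
  obtain ⟨S, hS⟩ := P.exists_solutionOperator hC₀
  have hex : ∀ v : L2 Ω, ∃! y : H10 Ω, P.IsState v y := fun v =>
    ⟨S (P.f + v), (hS v _).2 rfl, fun y hy => (hS v y).1 hy⟩
  have hstate : ∀ v, P.IsState v (P.state v) := fun v => Classical.epsilon_spec (hex v).exists
  have hT : ∀ v, toL2 (P.state v) = (toL2L Ω ∘L S) (P.f + v) := fun v => by
    rw [(hS v _).1 (hstate v), ContinuousLinearMap.comp_apply, toL2L_apply]
  -- By linearity `y(v) - y_d = S v + (S f - y_d)`, which fixes the constant term of the Tikhonov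
  -- functional.
  obtain ⟨u, hu⟩ := exists_tikhonov_minimizer (toL2L Ω ∘L S) ((toL2L Ω ∘L S) P.f - P.yd) P.ud
    P.lam_pos
  have hcost : ∀ v, P.cost (P.state v) v = P.cost (P.state u) u + P.errorSq u v := fun v => by
    have h := hu v
    have e1 : ∀ v, (toL2L Ω ∘L S) v + ((toL2L Ω ∘L S) P.f - P.yd) = toL2 (P.state v) - P.yd :=
      fun v => by rw [hT, map_add]; abel
    have e2 : (toL2L Ω ∘L S) (u - v) = toL2 (P.state u) - toL2 (P.state v) := by
      rw [hT, hT, map_sub, map_add, map_add]; abel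
    rwa [e1, e1, e2] at h
  have huniq : ∀ u', P.IsOptimalControl u' → u' = u := fun u' hu' => by
    have h1 := hu' u
    rw [hcost u', ControlProblem.errorSq] at h1
    have h2 := P.lam_pos
    have h3 : ‖u - u'‖ ^ 2 = 0 := by
      refine le_antisymm ?_ (sq_nonneg _)
      by_contra! h4
      have := mul_pos (half_pos h2) h4
      linarith [sq_nonneg ‖toL2 (P.state u) - toL2 (P.state u')‖]
    rw [sq_eq_zero_iff, norm_eq_zero, sub_eq_zero] at h3
    exact h3.symm
  have hopt : P.IsOptimalControl u := fun v => by
    rw [hcost v, ControlProblem.errorSq]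
    have := P.lam_pos
    linarith [show 0 ≤ 1 / 2 * ‖toL2 (P.state u) - toL2 (P.state v)‖ ^ 2
      + P.lam / 2 * ‖u - v‖ ^ 2 by positivity]
  refine ⟨⟨C₀, hC₀⟩, hex, ⟨u, hopt, huniq⟩, ?_⟩
  intro u' hu' C hC η ζ τ ρ α β hα hβ
  obtain rfl := huniq u' hu'
  refine ⟨?_, ?_⟩
  · have h1 := ControlProblem.cost_controlOf_le_costMajorant hC (hstate _) (ζ := ζ) η τ hα hβ
    have h2 := ControlProblem.costMinorant_le_cost hC (hstate u') η ζ τ ρ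
    rw [ControlProblem.errorMajorant]
    linarith [hcost (P.controlOf ζ)]
  · rw [ControlProblem.errorMajorant, ControlProblem.costMajorant, ControlProblem.costMinorant]
    ring
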